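/- Let $\beta,\kappa>0$, $\tfrac12-\tfrac{\sqrt3}{6}<\gamma_1<\tfrac12$ and $\gamma_2=1-\gamma_1$. Put $D(u)=\beta(u-\gamma_1)(u-\gamma_2)$, $\Phi(u)=\int_0^uD$, $f(u)=\kappa u(u-\alpha)(1-u)$, and consider the desingularised slow system $$u'=-(v+cu),\qquad v'=D(u)f(u),$$ whose equilibria $p_-=(1,-c)$ and $p_+=(0,0)$ are saddles when $0<\alpha<1$. The shock states $u_l<\gamma_1$ and $u_r>\gamma_2$ are chosen by the equal-area rule: $\Phi(u_l)=\Phi(u_r)=-w$ and $\int_{u_l}^{u_r}(w+\Phi(u))\,du=0$. (The lower bound on $\gamma_1$ says exactly that $0<u_l$ and $u_r<1$, that is, that the shock stays inside the density range $(0,1)$.) A singular heteroclinic orbit for $(\alpha,c)$ is a concatenation $\Gamma_r\cup\Gamma_-\cup\Gamma_l$ for which there is a number $v_h$ such that: $\Gamma_r$ is an orbit segment of the slow system in $\{u>\gamma_2\}$ on the unstable manifold of $p_-$, from $p_-$ to the first intersection $(u_r,v_h)$ with $\{u=u_r\}$; $\Gamma_-$ is a fast jump, i.e. a heteroclinic orbit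 from $(u_r,0)$ to $(u_l,0)$ of the layer problem $\dot u=\hat u$, $\dot{\hat u}=\Phi(u)-\Phi(u_r)$, at constant $v=v_h$; and $\Gamma_l$ is an orbit segment of the slow system in $\{u<\gamma_1\}$ on the stable manifold of $p_+$ that leads from $(u_l,v_h)$ to $p_+$ and does not meet $\{u=u_l\}$ again. Then the equal-area states $u_l,u_r$ exist with $0<u_l$ and $u_r<1$, and there are $h\in(0,\tfrac12]$, $\rho>0$ and a $C^\infty$ function $c:(\tfrac12-h,\tfrac12+h)\to(-\rho,\rho)$ with $c(\tfrac12)=0$ and $c'(\tfrac12)<0$ such that for all $\alpha\in(\tfrac12-h,\tfrac12+h)$ and $|\tilde c|<\rho$ there is a singular heteroclinic orbit for $(\alpha,\tilde c)$ if and only if $\tilde c=c(\alpha)$. Moreover $c(\alpha)>0$ (invasion fronts) for $\alpha\in(\tfrac12-h,\tfrac12)$ and $c(\alpha)<0$ (evasion fronts) for $\alpha\in(\tfrac12,\tfrac12+h)$. -/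

import Mathlib

open Set Filter Topology
open scoped ContDiff

namespace ShockFront

/-- The density-dependent diffusivity `D(u) = β (u - γ₁) (u - γ₂)`. -/
def diffusivity (β γ₁ γ₂ u : ℝ) : ℝ := β * (u - γ₁) * (u - γ₂)

/-- The potential `Φ`, the antiderivative of `D` with `Φ(0) = 0`. -/
noncomputable def potential (β γ₁ γ₂ u : ℝ) : ℝ :=
  β * u * (u ^ 2 / 3 - (γ₁ + γ₂) * u / 2 + γ₁ * γ₂)

theorem hasDerivAt_potential (β γ₁ γ₂ u : ℝ) :
    HasDerivAt (potential β γ₁ γ₂) (diffusivity β γ₁ γ₂ u) u := by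
  have h1 : HasDerivAt (fun x : ℝ => β * x) β u := by
    simpa using (hasDerivAt_id u).const_mul β
  have h2 : HasDerivAt (fun x : ℝ => x ^ 2 / 3 - (γ₁ + γ₂) * x / 2 + γ₁ * γ₂)
      (2 * u / 3 - (γ₁ + γ₂) / 2) u := by
    have h3 : HasDerivAt (fun x : ℝ => x ^ 2 / 3) (2 * u / 3) u := by
      simpa using (hasDerivAt_pow 2 u).div_const 3
    have h4 : HasDerivAt (fun x : ℝ => (γ₁ + γ₂) * x / 2) ((γ₁ + γ₂) / 2) u := by
      simpa using ((hasDerivAt_id u).const_mul (γ₁ + γ₂)).div_const 2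
    exact (h3.sub h4).add_const _
  have h5 := h1.mul h2
  have e : β * (u ^ 2 / 3 - (γ₁ + γ₂) * u / 2 + γ₁ * γ₂)
      + β * u * (2 * u / 3 - (γ₁ + γ₂) / 2) = diffusivity β γ₁ γ₂ u := by
    unfold diffusivity; ring
  rw [← e]
  exact h5

/-- The bistable reaction term `f(u) = κ u (u - α) (1 - u)`. -/
def reaction (κ α u : ℝ) : ℝ := κ * u * (u - α) * (1 - u)

/-- The desingularised slow system in the variables `(u, v)`:
`u' = -(v + c u)`, `v' = D(u) f(u)`. -/
def slowField (β κ γ₁ γ₂ α c : ℝ) (p : ℝ × ℝ) : ℝ × ℝ :=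
  (-(p.2 + c * p.1), diffusivity β γ₁ γ₂ p.1 * reaction κ α p.1)

/-- The fast layer problem in the variables `(u, û)`:
`u' = û`, `û' = w + Φ(u) - δ û`, where `w` and `δ` are parameters. -/
noncomputable def layerField (β γ₁ γ₂ δ w : ℝ) (q : ℝ × ℝ) : ℝ × ℝ :=
  (q.2, w + potential β γ₁ γ₂ q.1 - δ * q.2)

/-- `p` is an equilibrium of the planar vector field `X` whose linearisation has one negative and
one positive eigenvalue. -/
def IsSaddle (X : ℝ × ℝ → ℝ × ℝ) (p : ℝ × ℝ) : Prop :=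
  X p = 0 ∧ ∃ s r : ℝ, s < 0 ∧ 0 < r ∧
    Module.End.HasEigenvalue (fderiv ℝ X p : ℝ × ℝ →ₗ[ℝ] ℝ × ℝ) s ∧
    Module.End.HasEigenvalue (fderiv ℝ X p : ℝ × ℝ →ₗ[ℝ] ℝ × ℝ) r

/-- `γ` is a half-orbit `(-∞, 0] → ℝ²` of `X` with `γ(t) → p` as `t → -∞`; its points are points of
the unstable manifold of `p`. -/
def IsUnstableOrbit (X : ℝ × ℝ → ℝ × ℝ) (p : ℝ × ℝ) (γ : ℝ → ℝ × ℝ) : Prop :=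
  IsIntegralCurveOn γ (fun _ => X) (Iic 0) ∧ Tendsto γ atBot (𝓝 p)

/-- `γ` is a half-orbit `[0, ∞) → ℝ²` of `X` with `γ(t) → p` as `t → ∞`; its points are points of
the stable manifold of `p`. -/
def IsStableOrbit (X : ℝ × ℝ → ℝ × ℝ) (p : ℝ × ℝ) (γ : ℝ → ℝ × ℝ) : Prop :=
  IsIntegralCurveOn γ (fun _ => X) (Ici 0) ∧ Tendsto γ atTop (𝓝 p)

/-- `γ` is a complete orbit of `X` running from `p` to `q`. -/
def IsHeteroclinicOrbit (X : ℝ × ℝ → ℝ × ℝ) (p q : ℝ × ℝ) (γ : ℝ → ℝ × ℝ) : Prop :=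
  IsIntegralCurve γ (fun _ => X) ∧ Tendsto γ atBot (𝓝 p) ∧ Tendsto γ atTop (𝓝 q)

/-- The equal-area rule: `u_l < γ₁` and `u_r > γ₂` lie on the two outer branches of the potential,
at the same height `Φ(u_l) = Φ(u_r) = -w`, and `∫_{u_l}^{u_r} (w + Φ(u)) du = 0`. -/
def EqualAreaRule (β γ₁ γ₂ ul ur : ℝ) : Prop :=
  ul < γ₁ ∧ γ₂ < ur ∧ ∃ w : ℝ,
    potential β γ₁ γ₂ ul = -w ∧ potential β γ₁ γ₂ ur = -w ∧
    ∫ u in ul..ur, (w + potential β γ₁ γ₂ u) = 0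

/-- The singular heteroclinic orbit `Γ_r ∪ Γ_- ∪ Γ_l` from the saddle `(1, -c)` to the saddle
`(0, 0)` with a shock from `u = u_r` to `u = u_l`. It is the concatenation of

* a slow segment `Γ_r` on the right outer branch `{u > γ₂}`, contained in the unstable manifold of
  `(1, -c)` and ending at its first intersection `(u_r, v_h)` with the section `{u = u_r}`;
* a fast jump `Γ_-` at constant `v = v_h` and `w = -Φ(u_r)`, a heteroclinic orbit of the layer
  problem with `δ = a c` from `(u_r, 0)` to `(u_l, 0)`;
* a slow segment `Γ_l` on the left outer branch `{u < γ₁}`, contained in the stable manifold of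
  `(0, 0)`, starting at its first intersection `(u_l, v_h)` with the section `{u = u_l}`.

On the outer branches `D > 0`, so the time of the desingularised system has the orientation of the
travelling-wave coordinate. -/
def IsSingularHeteroclinic (β κ γ₁ γ₂ a α c ul ur : ℝ) : Prop :=
  IsSaddle (slowField β κ γ₁ γ₂ α c) (1, -c) ∧
  IsSaddle (slowField β κ γ₁ γ₂ α c) (0, 0) ∧
  ∃ vh : ℝ,
    (∃ Γr : ℝ → ℝ × ℝ, IsUnstableOrbit (slowField β κ γ₁ γ₂ α c) (1, -c) Γr ∧
      (∀ t ≤ 0, γ₂ < (Γr t).1) ∧ (∀ t < 0, (Γr t).1 ≠ ur) ∧ Γr 0 = (ur, vh)) ∧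
    (∃ Γm : ℝ → ℝ × ℝ,
      IsHeteroclinicOrbit (layerField β γ₁ γ₂ (a * c) (-potential β γ₁ γ₂ ur))
        (ur, 0) (ul, 0) Γm) ∧
    (∃ Γl : ℝ → ℝ × ℝ, IsStableOrbit (slowField β κ γ₁ γ₂ α c) (0, 0) Γl ∧
      (∀ t ≥ 0, (Γl t).1 < γ₁) ∧ (∀ t > 0, (Γl t).1 ≠ ul) ∧ Γl 0 = (ul, vh))

end ShockFront

/-! With `s = 1 - u` and `y = v + c u` the slow system becomes `s' = y`, `y' = s G(s) - c y`, where
`s G(s) = D f`. The branch of the unstable manifold of the right saddle with `s > 0` is a graph `y =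
s z(s)`. Integrating `y dy/ds = s G - c y` from the saddle and dividing by `s² / 2` gives `z² + 2 c
A z = 2 A G` with `(A z)(s) = ∫₀¹ τ z(τ s) dτ`. Thus a differential equation singular at the saddle
turns into a smooth equation between bounded continuous functions. At `c = 0` its positive root `z₀`
is explicit and the linearisation is multiplication by `2 z₀`, so the implicit function theorem
(`exists_profile`) yields a profile analytic in `(α, c)`.

`orbit_height_eq` and `exists_orbit_on_profile` identify the graph with the actual half-orbits. The
section `s = S` is therefore reached at the height `y = φ(α, c) = S z(S)`, and implicit
differentiation gives `∂φ/∂α < 0` and `∂φ/∂c < 0` at `(1/2, 0)` (`exists_segment_height`).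

The reflection `u ↦ 1 - u` with time reversal turns the left segment into a right one for `(1 - α,
-c)` (`hasLeftSegment_iff`). The equal-area states are `1/2 ∓ r`, symmetric about `1/2`, so both
segments use the same `φ`. The undamped fast jump exists for every `c`, so only the two values of
`v_h` have to agree: `φ(α, c) - φ(1 - α, -c) - 2 r c = 0`. Both partial derivatives of the left side
are negative at `(1/2, 0)`, hence the zero set is a decreasing curve `c(α)`
(`exists_decreasing_implicit_curve`). -/

namespace ShockFront

open scoped BoundedContinuousFunction

/-! ### The profile equation and its analytic solution -/

theorem norm_integral_weighted_le (z : ℝ →ᵇ ℝ) (s : ℝ) :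
    ‖∫ τ in (0 : ℝ)..1, τ * z (τ * s)‖ ≤ ‖z‖ := by
  have := intervalIntegral.norm_integral_le_of_norm_le_const
    (a := 0) (b := 1) (f := fun τ : ℝ => τ * z (τ * s)) (C := ‖z‖) (fun τ hτ => by
      rw [uIoc_of_le zero_le_one] at hτ
      rw [norm_mul, Real.norm_of_nonneg hτ.1.le]
      calc τ * ‖z (τ * s)‖ ≤ 1 * ‖z‖ :=
            mul_le_mul hτ.2 (z.norm_coe_le_norm _) (norm_nonneg _) zero_le_one
        _ = ‖z‖ := one_mul _)
  simpa using this

/-- The operator `z ↦ (s ↦ ∫₀¹ τ z(τ s) dτ)` on bounded continuous functions. -/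
noncomputable def weightedAverage : (ℝ →ᵇ ℝ) →L[ℝ] (ℝ →ᵇ ℝ) :=
  LinearMap.mkContinuous
    { toFun := fun z => BoundedContinuousFunction.ofNormedAddCommGroup
        (fun s => ∫ τ in (0 : ℝ)..1, τ * z (τ * s))
        (intervalIntegral.continuous_parametric_intervalIntegral_of_continuous'
          (by fun_prop) 0 1) ‖z‖ (norm_integral_weighted_le z)
      map_add' := fun z w => by
        ext s
        change (∫ τ in (0 : ℝ)..1, τ * (z (τ * s) + w (τ * s)))
          = (∫ τ in (0 : ℝ)..1, τ * z (τ * s)) + ∫ τ in (0 : ℝ)..1, τ * w (τ * s)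
        rw [← intervalIntegral.integral_add
          (Continuous.intervalIntegrable (by fun_prop) _ _)
          (Continuous.intervalIntegrable (by fun_prop) _ _)]
        simp only [mul_add]
      map_smul' := fun r z => by
        ext s
        change (∫ τ in (0 : ℝ)..1, τ * (r * z (τ * s)))
          = r * ∫ τ in (0 : ℝ)..1, τ * z (τ * s)
        rw [← intervalIntegral.integral_const_mul]
        congr 1; ext τ; ring } 1
    (fun z => (BoundedContinuousFunction.norm_ofNormedAddCommGroup_le _ (norm_nonneg z)
      (norm_integral_weighted_le z)).trans_eq (one_mul _).symm)

theorem weightedAverage_apply (z : ℝ →ᵇ ℝ) (s : ℝ) :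
    weightedAverage z s = ∫ τ in (0 : ℝ)..1, τ * z (τ * s) := rfl

/-- The substitution `t = τ s` links the average, which is regular at `s = 0`, to the energy
integral of the orbit equation. -/
theorem sq_mul_weightedAverage (z : ℝ →ᵇ ℝ) (s : ℝ) :
    s ^ 2 * weightedAverage z s = ∫ t in (0 : ℝ)..s, t * z t := by
  have h := intervalIntegral.smul_integral_comp_mul_right (a := 0) (b := 1)
    (fun t : ℝ => t * z t) s
  rw [zero_mul, one_mul] at h
  rw [← h, weightedAverage_apply, smul_eq_mul, pow_two, mul_assoc,
    ← intervalIntegral.integral_const_mul]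
  congr 2; ext τ; ring

theorem const_le_two_mul_weightedAverage {z : ℝ →ᵇ ℝ} {m : ℝ} (h : ∀ s, m ≤ z s) (s : ℝ) :
    m ≤ 2 * weightedAverage z s := by
  have h1 : ∫ τ in (0 : ℝ)..1, τ * m ≤ ∫ τ in (0 : ℝ)..1, τ * z (τ * s) :=
    intervalIntegral.integral_mono_on zero_le_one
      (Continuous.intervalIntegrable (by fun_prop) _ _)
      (Continuous.intervalIntegrable (by fun_prop) _ _)
      (fun τ hτ => mul_le_mul_of_nonneg_left (h _) hτ.1)
  rw [intervalIntegral.integral_mul_const, integral_id, ← weightedAverage_apply] at h1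
  linarith

/-- The nonlinear equation for the profile `z`, with `p = (α, c)`. -/
noncomputable def profileMap (P Q : ℝ →ᵇ ℝ) (x : (ℝ × ℝ) × (ℝ →ᵇ ℝ)) : ℝ →ᵇ ℝ :=
  x.2 * x.2 + (2 * x.1.2) • weightedAverage x.2 - (2 : ℝ) • weightedAverage (P - x.1.1 • Q)

theorem contDiff_profileMap (P Q : ℝ →ᵇ ℝ) : ContDiff ℝ ω (profileMap P Q) := by
  have h1 : ContDiff ℝ ω fun x : (ℝ × ℝ) × (ℝ →ᵇ ℝ) => weightedAverage x.2 :=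
    weightedAverage.contDiff.comp contDiff_snd
  have h2 : ContDiff ℝ ω fun x : (ℝ × ℝ) × (ℝ →ᵇ ℝ) => weightedAverage (P - x.1.1 • Q) :=
    weightedAverage.contDiff.comp
      (contDiff_const.sub ((contDiff_fst.comp contDiff_fst).smul contDiff_const))
  have h3 : ContDiff ℝ ω fun x : (ℝ × ℝ) × (ℝ →ᵇ ℝ) => 2 * x.1.2 :=
    contDiff_const.mul (contDiff_snd.comp contDiff_fst)
  exact ((contDiff_snd.mul contDiff_snd).add (h3.smul h1)).sub
    ((contDiff_const (c := (2 : ℝ))).smul h2)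

/-- Near `(α₀, 0)` the profile equation has a positive solution depending analytically on the
parameters. -/
theorem exists_profile (P Q : ℝ →ᵇ ℝ) {α₀ m : ℝ} (hm : 0 < m)
    (h : ∀ s, m ≤ P s - α₀ * Q s) :
    ∃ Z : ℝ × ℝ → (ℝ →ᵇ ℝ), ContDiffAt ℝ ω Z (α₀, 0) ∧
      ∀ᶠ p in 𝓝 (α₀, 0), (∃ μ > 0, ∀ s, μ ≤ Z p s) ∧ profileMap P Q (p, Z p) = 0 := by
  set R : ℝ →ᵇ ℝ := (2 : ℝ) • weightedAverage (P - α₀ • Q) with hR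
  have hRm : ∀ s, m ≤ R s := fun s => by
    have := const_le_two_mul_weightedAverage (z := P - α₀ • Q) (m := m) (fun s => by simpa using h s) s
    simpa [hR] using this
  have hRn : ∀ s, R s ≤ ‖R‖ := fun s => (le_abs_self _).trans (R.norm_coe_le_norm s)
  -- For `c = 0` the profile equation reads `z² = R`.
  set z₀ : ℝ →ᵇ ℝ := BoundedContinuousFunction.ofNormedAddCommGroup (fun s => √(R s))
    (by fun_prop) (√‖R‖) (fun s => by
      rw [Real.norm_of_nonneg (Real.sqrt_nonneg _)]; exact Real.sqrt_le_sqrt (hRn s)) with hz₀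
  have hz₀a : ∀ s, z₀ s = √(R s) := fun s => rfl
  have hsm : 0 < √m := Real.sqrt_pos.2 hm
  have hz₀m : ∀ s, √m ≤ z₀ s := fun s => Real.sqrt_le_sqrt (hRm s)
  have hz₀p : ∀ s, 0 < z₀ s := fun s => hsm.trans_le (hz₀m s)
  set w₀ : ℝ →ᵇ ℝ := BoundedContinuousFunction.ofNormedAddCommGroup (fun s => (2 * z₀ s)⁻¹)
    (Continuous.inv₀ (by fun_prop) (fun s => (mul_pos two_pos (hz₀p s)).ne')) ((2 * √m)⁻¹)
    (fun s => by
      have := hz₀m s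
      have := hz₀p s
      rw [Real.norm_of_nonneg (by positivity)]
      gcongr) with hw₀
  have hw₀a : ∀ s, w₀ s = (2 * z₀ s)⁻¹ := fun s => rfl
  have hzw : ∀ s, z₀ s * w₀ s = 1 / 2 := fun s => by
    have := (hz₀p s).ne'
    rw [hw₀a]; field_simp
  have h0 : profileMap P Q ((α₀, 0), z₀) = 0 := by
    have : z₀ * z₀ = R := by
      ext s
      simp only [BoundedContinuousFunction.mul_apply, hz₀a]
      exact Real.mul_self_sqrt (hm.le.trans (hRm s))
    simp [profileMap, this, hR]
  have hcd := (contDiff_profileMap P Q).contDiffAt (x := ((α₀, 0), z₀))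
  -- The averaging term carries the factor `2 c`, which vanishes here, so the partial derivative in
  -- `z` is `k ↦ 2 z₀ k`, with inverse multiplication by `w₀`.
  have hder : ∀ k, (fderiv ℝ (profileMap P Q) ((α₀, 0), z₀) ∘L .inr ℝ (ℝ × ℝ) (ℝ →ᵇ ℝ)) k
      = z₀ * k + k * z₀ := fun k => by
    have h1 : HasFDerivAt (fun z => profileMap P Q ((α₀, 0), z))
        (fderiv ℝ (profileMap P Q) ((α₀, 0), z₀) ∘L .inr ℝ (ℝ × ℝ) (ℝ →ᵇ ℝ)) z₀ :=
      HasFDerivAt.comp z₀ (hcd.differentiableAt (by simp)).hasFDerivAt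
        (hasFDerivAt_prodMk_right _ _)
    have h2 : HasFDerivAt (fun z => profileMap P Q ((α₀, 0), z))
        (z₀ • ContinuousLinearMap.id ℝ (ℝ →ᵇ ℝ) + z₀ • ContinuousLinearMap.id ℝ (ℝ →ᵇ ℝ)) z₀ := by
      have := ((hasFDerivAt_id (𝕜 := ℝ) z₀).mul (hasFDerivAt_id (𝕜 := ℝ) z₀)).sub_const R
      refine this.congr_of_eventuallyEq (Eventually.of_forall fun z => ?_)
      simp [profileMap, hR]
    rw [h1.unique h2]
    simp [mul_comm]
  have hinv : (fderiv ℝ (profileMap P Q) ((α₀, 0), z₀) ∘L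
      .inr ℝ (ℝ × ℝ) (ℝ →ᵇ ℝ)).IsInvertible := by
    refine ⟨ContinuousLinearEquiv.equivOfInverse
      (fderiv ℝ (profileMap P Q) ((α₀, 0), z₀) ∘L .inr ℝ (ℝ × ℝ) (ℝ →ᵇ ℝ)) (w₀ • ContinuousLinearMap.id ℝ (ℝ →ᵇ ℝ))
      ?_ ?_, by ext; rfl⟩
    · intro k
      rw [hder]; ext s
      have := hzw s
      simp only [smul_apply, ContinuousLinearMap.id_apply, smul_eq_mul,
        BoundedContinuousFunction.mul_apply, BoundedContinuousFunction.add_apply]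
      linear_combination (2 * k s) * this
    · intro k
      rw [hder]; ext s
      have := hzw s
      simp only [smul_apply, ContinuousLinearMap.id_apply, smul_eq_mul,
        BoundedContinuousFunction.mul_apply, BoundedContinuousFunction.add_apply]
      linear_combination (2 * k s) * this
  have hω : (ω : WithTop ℕ∞) ≠ 0 := by simp
  refine ⟨hcd.implicitFunction hω hinv, hcd.contDiffAt_implicitFunction hω hinv, ?_⟩
  have hself := hcd.implicitFunction_apply_self hω hinv
  have hcont := (hcd.contDiffAt_implicitFunction hω hinv).continuousAt
  -- Since `z₀ ≥ √m`, uniform distance below `√m / 2` leaves the lower bound `√m / 2`.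
  have hnear : ∀ᶠ p in 𝓝 (α₀, (0 : ℝ)), dist (hcd.implicitFunction hω hinv p) z₀ < √m / 2 := by
    have := Metric.tendsto_nhds.1 hcont (√m / 2) (by positivity)
    simpa only [hself] using this
  filter_upwards [hnear, hcd.eventually_apply_implicitFunction hω hinv] with p hp hp'
  refine ⟨⟨√m / 2, by positivity, fun s => ?_⟩, hp'.trans h0⟩
  have h3 := (BoundedContinuousFunction.dist_coe_le_dist s).trans_lt hp
  rw [Real.dist_eq] at h3
  have := (abs_lt.1 h3).1
  have := hz₀m s
  linarith

/-- Multiplied by `s²`, the profile equation expresses `(s z)²` through integrals. It is thus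
differentiable although `z` is only assumed continuous, and positivity allows the square root to be
taken. -/
theorem hasDerivAt_mul_profile {z g : ℝ →ᵇ ℝ} {c : ℝ} (hz : ∀ s, 0 < z s)
    (h : z * z + (2 * c) • weightedAverage z - (2 : ℝ) • weightedAverage g = 0)
    {s : ℝ} (hs : 0 < s) : HasDerivAt (fun x => x * z x) (g s / z s - c) s := by
  have hq : ∀ x, (x * z x) ^ 2
      = 2 * (∫ t in (0 : ℝ)..x, t * g t) - 2 * c * ∫ t in (0 : ℝ)..x, t * z t := fun x => by
    have hx := congrArg (fun w : ℝ →ᵇ ℝ => w x) h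
    simp only [BoundedContinuousFunction.sub_apply, BoundedContinuousFunction.add_apply,
      BoundedContinuousFunction.mul_apply, BoundedContinuousFunction.smul_apply,
      BoundedContinuousFunction.coe_zero, Pi.zero_apply, smul_eq_mul] at hx
    rw [← sq_mul_weightedAverage, ← sq_mul_weightedAverage]
    linear_combination x ^ 2 * hx
  have hint : ∀ w : ℝ →ᵇ ℝ, HasDerivAt (fun x => ∫ t in (0 : ℝ)..x, t * w t) (s * w s) s :=
    fun w => intervalIntegral.integral_hasDerivAt_right
      (Continuous.intervalIntegrable (by fun_prop) _ _)
      (Continuous.stronglyMeasurableAtFilter (by fun_prop) _ _)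
      (Continuous.continuousAt (by fun_prop))
  have h1 : HasDerivAt (fun x => (x * z x) ^ 2) (2 * (s * g s) - 2 * c * (s * z s)) s := by
    simp only [hq]
    exact ((hint g).const_mul 2).sub ((hint z).const_mul (2 * c))
  have hsz : 0 < s * z s := mul_pos hs (hz s)
  have h2 := h1.sqrt (pow_ne_zero 2 hsz.ne')
  rw [Real.sqrt_sq hsz.le] at h2
  have e : (2 * (s * g s) - 2 * c * (s * z s)) / (2 * (s * z s)) = g s / z s - c := by
    have := hs.ne'
    have := (hz s).ne'
    field_simp
  rw [e] at h2
  refine h2.congr_of_eventuallyEq ?_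
  filter_upwards [Ioi_mem_nhds hs] with x hx
  rw [Real.sqrt_sq (mul_pos hx (hz x)).le]

/-! ### Half-orbits emanating from the saddle, and the profile graph -/

section Uniqueness

variable {G : ℝ → ℝ} {c S : ℝ} {s y : ℝ → ℝ}

/-- A half-orbit of `s' = y`, `y' = s G(s) - c y` that emanates from the origin and ends at a
positive value of `s` has `s > 0` throughout. -/
theorem pos_of_tendsto_zero (hG : Continuous G)
    (hs : ∀ t ≤ 0, HasDerivWithinAt s (y t) (Iic 0) t)
    (hy : ∀ t ≤ 0, HasDerivWithinAt y (s t * G (s t) - c * y t) (Iic 0) t)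
    (hs0 : Tendsto s atBot (𝓝 0)) (hy0 : Tendsto y atBot (𝓝 0))
    (hS : 0 < s 0) (hpos : ∀ t ≤ 0, 0 < G (s t)) : ∀ t ≤ 0, 0 < s t := by
  have hsc : ContinuousOn s (Iic 0) := fun t ht => (hs t ht).continuousWithinAt
  have hyc : ContinuousOn y (Iic 0) := fun t ht => (hy t ht).continuousWithinAt
  have hsd : ∀ t < 0, HasDerivAt s (y t) t := fun t ht =>
    (hs t ht.le).hasDerivAt (Iic_mem_nhds ht)
  have hyd : ∀ t < 0, HasDerivAt y (s t * G (s t) - c * y t) t := fun t ht =>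
    (hy t ht.le).hasDerivAt (Iic_mem_nhds ht)
  -- The term `c / 2 * s²` cancels the damping: `Q' = y² + s² G ≥ 0`. As `Q → 0` at `-∞`, `Q` is
  -- nonnegative.
  set Q : ℝ → ℝ := fun t => y t * s t + c / 2 * s t ^ 2 with hQ
  have hQd : ∀ t < 0, HasDerivAt Q (y t ^ 2 + s t ^ 2 * G (s t)) t := fun t ht => by
    have := ((hyd t ht).mul (hsd t ht)).add (((hsd t ht).pow 2).const_mul (c / 2))
    refine this.congr_deriv ?_
    push_cast; ring
  have hQm : MonotoneOn Q (Iic 0) := by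
    refine monotoneOn_of_hasDerivWithinAt_nonneg (convex_Iic 0)
      (f' := fun t => y t ^ 2 + s t ^ 2 * G (s t))
      ((hyc.mul hsc).add ((hsc.pow 2).const_smul (c / 2))) ?_ ?_
    · intro t ht; rw [interior_Iic] at ht; exact (hQd t ht).hasDerivWithinAt
    · intro t ht; rw [interior_Iic] at ht; have := hpos t ht.le; positivity
  have hQ0 : Tendsto Q atBot (𝓝 0) := by
    simpa using (hy0.mul hs0).add ((hs0.pow 2).const_mul (c / 2))
  have hQn : ∀ t ≤ 0, 0 ≤ Q t := fun t ht =>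
    le_of_tendsto hQ0 (by
      filter_upwards [Iic_mem_atBot t] with r hr
      exact hQm (le_trans hr ht) ht hr)
  have hne : ∀ t ≤ 0, s t ≠ 0 := by
    intro t₀ ht₀ h0
    have ht₀' : t₀ < 0 := ht₀.lt_of_ne (fun h => by rw [h] at h0; exact hS.ne' h0)
    -- A zero of `s` is a minimum of `Q`, so `Q' = 0` forces `y = 0` there. The Grönwall estimate
    -- below then keeps the orbit at the origin up to time `0`, contradicting `s 0 > 0`.
    have hmin : IsLocalMin Q t₀ := by
      filter_upwards [Iic_mem_nhds ht₀'] with t ht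
      have : Q t₀ = 0 := by simp [hQ, h0]
      rw [this]; exact hQn t ht
    have hy1 := hmin.hasDerivAt_eq_zero (hQd t₀ ht₀')
    have hy2 : y t₀ = 0 := by simpa [h0] using hy1
    have hsub : Icc t₀ 0 ⊆ Iic (0 : ℝ) := fun t ht => ht.2
    obtain ⟨B, hB⟩ := isCompact_Icc.exists_bound_of_continuousOn
      (hG.comp_continuousOn (hsc.mono hsub))
    -- Dominates the growth rate of `s² + y²`: `2 s y (1 + G) ≤ (1 + B)(s² + y²)`, and the damping
    -- contributes at most `2 |c| y²`.
    set K := 1 + B + 2 * |c|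
    have hanti : AntitoneOn (fun t => (s t ^ 2 + y t ^ 2) * Real.exp (-K * t)) (Icc t₀ 0) := by
      refine antitoneOn_of_hasDerivWithinAt_nonpos (convex_Icc t₀ 0)
        (f' := fun t => (2 * s t * y t + 2 * y t * (s t * G (s t) - c * y t)
          - K * (s t ^ 2 + y t ^ 2)) * Real.exp (-K * t))
        ((((hsc.mono hsub).pow 2).add ((hyc.mono hsub).pow 2)).mul
          (Continuous.continuousOn (by fun_prop))) ?_ ?_
      · intro t ht
        rw [interior_Icc] at ht
        have he : HasDerivAt (fun t => Real.exp (-K * t)) (Real.exp (-K * t) * (-K * 1)) t :=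
          ((hasDerivAt_id t).const_mul (-K)).exp
        have := (((hsd t ht.2).pow 2).add ((hyd t ht.2).pow 2)).mul he
        refine (this.congr_deriv ?_).hasDerivWithinAt
        simp only [Pi.add_apply, Pi.pow_apply]
        push_cast; ring
      · intro t ht
        rw [interior_Icc] at ht
        refine mul_nonpos_of_nonpos_of_nonneg ?_ (Real.exp_pos _).le
        have hGt : G (s t) ≤ B := (le_abs_self _).trans (hB t ⟨ht.1.le, ht.2.le⟩)
        have hGp := hpos t ht.2.le
        have hc1 := neg_abs_le c
        have e : 2 * s t * y t + 2 * y t * (s t * G (s t) - c * y t) - K * (s t ^ 2 + y t ^ 2)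
          = -(s t - y t) ^ 2 - G (s t) * (s t - y t) ^ 2
            - (B - G (s t)) * (s t ^ 2 + y t ^ 2) - 2 * |c| * s t ^ 2
            - 2 * (|c| + c) * y t ^ 2 := by simp only [K]; ring
        rw [e]
        have h1 := mul_nonneg hGp.le (sq_nonneg (s t - y t))
        have h2 := mul_nonneg (sub_nonneg.2 hGt) (add_nonneg (sq_nonneg (s t)) (sq_nonneg (y t)))
        have h3 := mul_nonneg (abs_nonneg c) (sq_nonneg (s t))
        have h4 := mul_nonneg (show 0 ≤ |c| + c by linarith) (sq_nonneg (y t))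
        have h5 := sq_nonneg (s t - y t)
        linarith
    have := hanti (left_mem_Icc.2 ht₀) (right_mem_Icc.2 ht₀) ht₀
    simp only [h0, hy2, mul_zero, Real.exp_zero, mul_one] at this
    nlinarith [sq_nonneg (y 0), pow_pos hS 2]
  intro t ht
  by_contra hlt
  obtain ⟨r, hr, hr0⟩ := intermediate_value_Icc ht (hsc.mono (fun x hx => hx.2))
    (show (0 : ℝ) ∈ Icc (s t) (s 0) from ⟨not_lt.1 hlt, hS.le⟩)
  exact hne r hr.2 hr0

/-- Such a half-orbit lies on the graph `y = s z(s)` of the profile. -/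
theorem orbit_height_eq {z g : ℝ →ᵇ ℝ} (hz : ∀ s, 0 < z s)
    (h : z * z + (2 * c) • weightedAverage z - (2 : ℝ) • weightedAverage g = 0)
    (hG : Continuous G) (hg : ∀ x, 0 < x → x ≤ S → g x = G x)
    (hs : ∀ t ≤ 0, HasDerivWithinAt s (y t) (Iic 0) t)
    (hy : ∀ t ≤ 0, HasDerivWithinAt y (s t * G (s t) - c * y t) (Iic 0) t)
    (hs0 : Tendsto s atBot (𝓝 0)) (hy0 : Tendsto y atBot (𝓝 0))
    (hS : 0 < S) (hsS : s 0 = S) (hle : ∀ t ≤ 0, s t ≤ S) (hpos : ∀ t ≤ 0, 0 < G (s t)) :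
    y 0 = S * z S := by
  have hsp := pos_of_tendsto_zero hG hs hy hs0 hy0 (hsS ▸ hS) hpos
  -- The deviation from the graph satisfies `e' = -(G / z) e`, so `e²` is nonincreasing; it tends to
  -- `0` at `-∞` and must vanish.
  set e : ℝ → ℝ := fun t => y t - s t * z (s t) with he
  have hed : ∀ t ≤ 0, HasDerivWithinAt e (-(G (s t) / z (s t)) * e t) (Iic 0) t := fun t ht => by
    have h1 := (hasDerivAt_mul_profile hz h (hsp t ht)).comp_hasDerivWithinAt t (hs t ht)
    refine ((hy t ht).sub h1).congr_deriv ?_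
    rw [hg _ (hsp t ht) (hle t ht)]
    have := (hz (s t)).ne'
    simp only [he]
    field_simp
    ring
  have hanti : AntitoneOn (fun t => e t ^ 2) (Iic 0) := by
    refine antitoneOn_of_hasDerivWithinAt_nonpos (convex_Iic 0)
      (f' := fun t => -(2 * (G (s t) / z (s t)) * e t ^ 2))
      (fun t ht => ((hed t ht).continuousWithinAt.pow 2)) ?_ ?_
    · intro t ht
      refine (((hed t (mem_Iic.1 (interior_subset ht))).pow 2).mono interior_subset).congr_deriv ?_
      push_cast; ring
    · intro t ht
      have h1 := hpos t (mem_Iic.1 (interior_subset ht))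
      have h2 := hz (s t)
      have : 0 ≤ 2 * (G (s t) / z (s t)) * e t ^ 2 := by positivity
      linarith
  have he0 : Tendsto (fun t => e t ^ 2) atBot (𝓝 0) := by
    have h1 : Tendsto (fun t => s t * z (s t)) atBot (𝓝 0) := by
      simpa using hs0.mul ((z.continuous.tendsto 0).comp hs0)
    simpa [he] using (hy0.sub h1).pow 2
  have h1 : e 0 ^ 2 ≤ 0 := ge_of_tendsto he0 (by
    filter_upwards [Iic_mem_atBot 0] with t ht
    exact hanti ht (mem_Iic.2 le_rfl) ht)
  have h2 : e 0 = 0 := pow_eq_zero_iff two_ne_zero |>.1 (le_antisymm h1 (sq_nonneg _))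
  simp only [he, hsS] at h2
  linarith

end Uniqueness

/-- The scalar flow on the graph of the profile. -/
theorem exists_orbit_on_profile {z : ℝ →ᵇ ℝ} {μ S : ℝ} (hμ : 0 < μ) (hz : ∀ s, μ ≤ z s)
    (hS : 0 < S) :
    ∃ s : ℝ → ℝ, s 0 = S ∧ StrictMono s ∧ (∀ t, 0 < s t) ∧ Tendsto s atBot (𝓝 0) ∧
      ∀ t, HasDerivAt s (s t * z (s t)) t := by
  have hzp : ∀ x, 0 < z x := fun x => hμ.trans_le (hz x)
  have hzM : ∀ x, z x ≤ ‖z‖ := fun x => (le_abs_self _).trans (z.norm_coe_le_norm x)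
  have hM : 0 < ‖z‖ := (hzp 0).trans_le (hzM 0)
  -- With `s = S exp θ` the flow is `θ' = z(S exp θ)`. The elapsed time is `T θ = ∫ k`; since `k ≥ 1
  -- / ‖z‖`, it maps onto the whole line and can be inverted.
  set k : ℝ → ℝ := fun x => (z (S * Real.exp x))⁻¹ with hk
  have hkc : Continuous k := Continuous.inv₀ (by fun_prop) (fun x => (hzp _).ne')
  have hkp : ∀ x, 0 < k x := fun x => inv_pos.2 (hzp _)
  have hkM : ∀ x, ‖z‖⁻¹ ≤ k x := fun x => inv_anti₀ (hzp _) (hzM _)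
  set T : ℝ → ℝ := fun θ => ∫ x in (0 : ℝ)..θ, k x with hT
  have hTd : ∀ θ, HasDerivAt T (k θ) θ := fun θ =>
    intervalIntegral.integral_hasDerivAt_right (hkc.intervalIntegrable _ _)
      (hkc.stronglyMeasurableAtFilter _ _) hkc.continuousAt
  have hT0 : T 0 = 0 := intervalIntegral.integral_same
  have hTm : StrictMono T := strictMono_of_deriv_pos (fun θ => by rw [(hTd θ).deriv]; exact hkp θ)
  have hTc : Continuous T := continuous_iff_continuousAt.2 fun θ => (hTd θ).continuousAt
  have hlin : Monotone (fun θ => T θ - ‖z‖⁻¹ * θ) := by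
    have hd : ∀ θ, HasDerivAt (fun θ => T θ - ‖z‖⁻¹ * θ) (k θ - ‖z‖⁻¹ * 1) θ := fun θ =>
      (hTd θ).sub ((hasDerivAt_id θ).const_mul _)
    refine monotone_of_deriv_nonneg (fun θ => (hd θ).differentiableAt) (fun θ => ?_)
    rw [(hd θ).deriv, mul_one]
    exact sub_nonneg.2 (hkM θ)
  have htop : Tendsto T atTop atTop := by
    refine tendsto_atTop_mono' _ ?_ (tendsto_id.const_mul_atTop (inv_pos.2 hM))
    filter_upwards [Ici_mem_atTop 0] with θ hθ
    have := hlin hθ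
    simp only [hT0, mul_zero, sub_zero, id] at this ⊢
    linarith
  have hbot : Tendsto T atBot atBot := by
    refine tendsto_atBot_mono' _ ?_ (tendsto_id.const_mul_atBot (inv_pos.2 hM))
    filter_upwards [Iic_mem_atBot 0] with θ hθ
    have := hlin hθ
    simp only [hT0, mul_zero, sub_zero, id] at this ⊢
    linarith
  set Θ : ℝ ≃o ℝ := (hTm.orderIsoOfSurjective T (hTc.surjective htop hbot)).symm with hΘ
  have hTΘ : ∀ t, T (Θ t) = t := fun t =>
    (hTm.orderIsoOfSurjective T (hTc.surjective htop hbot)).apply_symm_apply t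
  have hΘ0 : Θ 0 = 0 := hTm.injective (by rw [hTΘ, hT0])
  have hΘd : ∀ t, HasDerivAt Θ (z (S * Real.exp (Θ t))) t := fun t => by
    have := HasDerivAt.of_local_left_inverse (f := T) Θ.continuous.continuousAt (hTd (Θ t))
      (hkp _).ne' (Eventually.of_forall hTΘ)
    simpa [hk] using this
  refine ⟨fun t => S * Real.exp (Θ t), by simp [hΘ0], ?_, fun t => by positivity, ?_, fun t => ?_⟩
  · exact fun a b hab => mul_lt_mul_of_pos_left (Real.exp_lt_exp.2 (Θ.strictMono hab)) hS
  · have := (Real.tendsto_exp_atBot.comp Θ.tendsto_atBot).const_mul S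
    simpa using this
  · refine ((hΘd t).exp.const_mul S).congr_deriv ?_
    ring

/-! ### Linearisation at the equilibria -/

/-- The characteristic equation is `l² + c l - q = 0`; the product of its roots is `-q < 0`,
whatever the sign of `c`. -/
theorem isSaddle_slowField {β κ γ₁ γ₂ α c u₀ q : ℝ} (hq : 0 < q)
    (h0 : diffusivity β γ₁ γ₂ u₀ * reaction κ α u₀ = 0)
    (hd : HasDerivAt (fun u => diffusivity β γ₁ γ₂ u * reaction κ α u) (-q) u₀) :
    IsSaddle (slowField β κ γ₁ γ₂ α c) (u₀, -(c * u₀)) := by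
  refine ⟨by simp [slowField, h0], ?_⟩
  have hf : HasFDerivAt (slowField β κ γ₁ γ₂ α c)
      ((-(ContinuousLinearMap.snd ℝ ℝ ℝ + c • ContinuousLinearMap.fst ℝ ℝ ℝ)).prod
        ((-q) • ContinuousLinearMap.fst ℝ ℝ ℝ)) (u₀, -(c * u₀)) := by
    refine HasFDerivAt.prodMk (𝕜 := ℝ) ?_ ?_
    · exact ((hasFDerivAt_snd (𝕜 := ℝ)).add ((hasFDerivAt_fst (𝕜 := ℝ)).const_mul c)).neg
    · exact HasDerivAt.comp_hasFDerivAt (u₀, -(c * u₀)) (f := Prod.fst) hd (hasFDerivAt_fst (𝕜 := ℝ))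
  rw [hf.fderiv]
  have key : ∀ l : ℝ, l ^ 2 + c * l - q = 0 → Module.End.HasEigenvalue
      (((-(ContinuousLinearMap.snd ℝ ℝ ℝ + c • ContinuousLinearMap.fst ℝ ℝ ℝ)).prod
        ((-q) • ContinuousLinearMap.fst ℝ ℝ ℝ) : ℝ × ℝ →L[ℝ] ℝ × ℝ) : ℝ × ℝ →ₗ[ℝ] ℝ × ℝ) l := by
    intro l hl
    refine Module.End.hasEigenvalue_of_hasEigenvector (x := (1, -(c + l))) ⟨?_, by simp⟩
    rw [Module.End.mem_eigenspace_iff]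
    ext
    · simp
    · simp
      linear_combination hl
  have hr : |c| < √(c ^ 2 + 4 * q) := by
    rw [← Real.sqrt_sq_eq_abs]
    exact Real.sqrt_lt_sqrt (sq_nonneg c) (by linarith)
  have hr2 : √(c ^ 2 + 4 * q) ^ 2 = c ^ 2 + 4 * q := Real.sq_sqrt (by positivity)
  obtain ⟨h1, h2⟩ := abs_lt.1 hr
  refine ⟨(-c - √(c ^ 2 + 4 * q)) / 2, (-c + √(c ^ 2 + 4 * q)) / 2, by linarith, by linarith,
    key _ ?_, key _ ?_⟩ <;> linear_combination hr2 / 4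

theorem isSaddle_one {β κ γ₁ α : ℝ} (c : ℝ) (hβ : 0 < β) (hκ : 0 < κ) (h₁ : 0 < γ₁)
    (h₁' : γ₁ < 1) (hα : α < 1) :
    IsSaddle (slowField β κ γ₁ (1 - γ₁) α c) (1, -c) := by
  have hq : 0 < β * γ₁ * (1 - γ₁) * κ * (1 - α) := by
    have := sub_pos.2 h₁'
    have := sub_pos.2 hα
    positivity
  have := isSaddle_slowField (β := β) (κ := κ) (γ₁ := γ₁) (γ₂ := 1 - γ₁) (α := α) (c := c)
    (u₀ := 1) hq (by simp [reaction]) (by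
      unfold diffusivity reaction
      have hx := hasDerivAt_id (1 : ℝ)
      have := (((hx.sub_const γ₁).const_mul β).mul (hx.sub_const (1 - γ₁))).mul
        (((hx.const_mul κ).mul (hx.sub_const α)).mul (hx.const_sub 1))
      refine this.congr_deriv ?_
      simp
      ring)
  simpa using this

theorem isSaddle_zero {β κ γ₁ α : ℝ} (c : ℝ) (hβ : 0 < β) (hκ : 0 < κ) (h₁ : 0 < γ₁)
    (h₁' : γ₁ < 1) (hα : 0 < α) :
    IsSaddle (slowField β κ γ₁ (1 - γ₁) α c) (0, 0) := by
  have hq : 0 < β * γ₁ * (1 - γ₁) * κ * α := by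
    have := sub_pos.2 h₁'
    positivity
  have := isSaddle_slowField (β := β) (κ := κ) (γ₁ := γ₁) (γ₂ := 1 - γ₁) (α := α) (c := c)
    (u₀ := 0) hq (by simp [reaction]) (by
      unfold diffusivity reaction
      have hx := hasDerivAt_id (0 : ℝ)
      have := (((hx.sub_const γ₁).const_mul β).mul (hx.sub_const (1 - γ₁))).mul
        (((hx.const_mul κ).mul (hx.sub_const α)).mul (hx.const_sub 1))
      refine this.congr_deriv ?_
      simp
      ring)
  simpa using this

/-! ### The equal-area states and the fast jump -/

/-- About `1/2` the potential is an odd cubic up to a constant, which makes the equal-area rule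
explicit. -/
theorem potential_half_add (β γ₁ x : ℝ) :
    potential β γ₁ (1 - γ₁) (1 / 2 + x)
      = potential β γ₁ (1 - γ₁) (1 / 2) + β * (x ^ 3 / 3 - (1 / 2 - γ₁) ^ 2 * x) := by
  unfold potential; ring

theorem equalAreaRule_symmetric {β γ₁ r : ℝ} (hγ₁ : γ₁ < 1 / 2)
    (hr : r ^ 2 = 3 * (1 / 2 - γ₁) ^ 2) (hr0 : 0 < r) :
    EqualAreaRule β γ₁ (1 - γ₁) (1 / 2 - r) (1 / 2 + r) := by
  have hlt : 1 / 2 - γ₁ < r := by nlinarith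
  refine ⟨by linarith, by linarith, -potential β γ₁ (1 - γ₁) (1 / 2), ?_, ?_, ?_⟩
  · rw [sub_eq_add_neg (1 / 2) r, potential_half_add]
    linear_combination (-β * r / 3) * hr
  · rw [potential_half_add]
    linear_combination (β * r / 3) * hr
  -- The antiderivative is even about `1/2`, so it takes the same value at both states.
  · have hd : ∀ u : ℝ, HasDerivAt
        (fun u => β * ((u - 1 / 2) ^ 4 / 12 - (1 / 2 - γ₁) ^ 2 * (u - 1 / 2) ^ 2 / 2))
        (-potential β γ₁ (1 - γ₁) (1 / 2) + potential β γ₁ (1 - γ₁) u) u := fun u => by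
      have hx := (hasDerivAt_id u).sub_const (1 / 2)
      have := (((hx.pow 4).div_const 12).sub
        (((hx.pow 2).const_mul ((1 / 2 - γ₁) ^ 2)).div_const 2)).const_mul β
      refine this.congr_deriv ?_
      have h2 := potential_half_add β γ₁ (u - 1 / 2)
      rw [add_sub_cancel] at h2
      rw [h2]
      simp only [id]
      push_cast; ring
    rw [intervalIntegral.integral_eq_sub_of_hasDerivAt (fun u _ => hd u)
      (Continuous.intervalIntegrable (by unfold potential; fun_prop) _ _)]
    ring

theorem exists_fast_jump {β γ₁ r : ℝ} (hβ : 0 < β) (hr : r ^ 2 = 3 * (1 / 2 - γ₁) ^ 2)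
    (hr0 : 0 < r) :
    ∃ Γ : ℝ → ℝ × ℝ, IsHeteroclinicOrbit
      (layerField β γ₁ (1 - γ₁) 0 (-potential β γ₁ (1 - γ₁) (1 / 2 + r)))
      (1 / 2 + r, 0) (1 / 2 - r, 0) Γ := by
  -- With `u = 1/2 + x` the layer problem is `x'' = (β / 3) x (x² - r²)`, solved by the kink `x = -r
  -- tanh (k t)` with `2 k² = β r² / 3`. Below, `τ = -tanh (k t)`, so `τ' = k (τ² - 1)`.
  set k : ℝ := √(β * r ^ 2 / 6) with hk
  have hk0 : 0 < k := Real.sqrt_pos.2 (by positivity)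
  have hk2 : k ^ 2 = β * r ^ 2 / 6 := Real.sq_sqrt (by positivity)
  set τ : ℝ → ℝ := fun t => 2 / (1 + Real.exp (2 * k * t)) - 1 with hτ
  have hτd : ∀ t, HasDerivAt τ (k * (τ t ^ 2 - 1)) t := fun t => by
    have he : HasDerivAt (fun t => 1 + Real.exp (2 * k * t))
        (Real.exp (2 * k * t) * (2 * k * 1)) t :=
      (((hasDerivAt_id t).const_mul (2 * k)).exp).const_add 1
    have hp : 1 + Real.exp (2 * k * t) ≠ 0 := by positivity
    refine (((hasDerivAt_const t (2 : ℝ)).div he hp).sub_const 1).congr_deriv ?_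
    simp only [hτ]
    field_simp
    ring
  have hbot : Tendsto τ atBot (𝓝 1) := by
    have h1 : Tendsto (fun t => Real.exp (2 * k * t)) atBot (𝓝 0) :=
      Real.tendsto_exp_atBot.comp (tendsto_id.const_mul_atBot (by positivity))
    have h2 := ((tendsto_const_nhds (x := (2 : ℝ))).div (h1.const_add 1) (by norm_num)).sub_const 1
    norm_num at h2
    exact h2
  have htop : Tendsto τ atTop (𝓝 (-1)) := by
    have h1 : Tendsto (fun t => 1 + Real.exp (2 * k * t)) atTop atTop :=
      tendsto_atTop_add_const_left _ 1
        (Real.tendsto_exp_atTop.comp (tendsto_id.const_mul_atTop (by positivity)))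
    simpa using (h1.const_div_atTop 2).sub_const 1
  have hτd2 : ∀ t, HasDerivAt (fun t => r * (k * (τ t ^ 2 - 1)))
      (2 * r * k ^ 2 * τ t * (τ t ^ 2 - 1)) t := fun t => by
    refine (((((hτd t).pow 2).sub_const 1).const_mul k).const_mul r).congr_deriv ?_
    push_cast; ring
  refine ⟨fun t => (1 / 2 + r * τ t, r * (k * (τ t ^ 2 - 1))), ?_, ?_, ?_⟩
  · intro t
    refine ((((hτd t).const_mul r).const_add (1 / 2)).prodMk (hτd2 t)).congr_deriv ?_
    ext
    · simp [layerField]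
    · simp only [layerField, potential_half_add]
      linear_combination (2 * r * τ t * (τ t ^ 2 - 1)) * hk2 + (β * r * (1 - τ t) / 3) * hr
  · have := ((hbot.const_mul r).const_add (1 / 2)).prodMk_nhds
      ((((hbot.pow 2).sub_const 1).const_mul k).const_mul r)
    simpa using this
  · have := ((htop.const_mul r).const_add (1 / 2)).prodMk_nhds
      ((((htop.pow 2).sub_const 1).const_mul k).const_mul r)
    simpa [sub_eq_add_neg] using this

/-! ### The slow segments -/

/-- The slow segment on the right outer branch, ending at `(u_r, v_h)`. -/
def HasRightSegment (β κ γ₁ γ₂ α c ur vh : ℝ) : Prop :=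
  ∃ Γr : ℝ → ℝ × ℝ, IsUnstableOrbit (slowField β κ γ₁ γ₂ α c) (1, -c) Γr ∧
    (∀ t ≤ 0, γ₂ < (Γr t).1) ∧ (∀ t < 0, (Γr t).1 ≠ ur) ∧ Γr 0 = (ur, vh)

/-- The slow segment on the left outer branch, starting at `(u_l, v_h)`. -/
def HasLeftSegment (β κ γ₁ γ₂ α c ul vh : ℝ) : Prop :=
  ∃ Γl : ℝ → ℝ × ℝ, IsStableOrbit (slowField β κ γ₁ γ₂ α c) (0, 0) Γl ∧
    (∀ t ≥ 0, (Γl t).1 < γ₁) ∧ (∀ t > 0, (Γl t).1 ≠ ul) ∧ Γl 0 = (ul, vh)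

theorem isIntegralCurveOn_prod_iff {X : ℝ × ℝ → ℝ × ℝ} {γ : ℝ → ℝ × ℝ} {I : Set ℝ} :
    IsIntegralCurveOn γ (fun _ => X) I ↔
      ∀ t ∈ I, HasDerivWithinAt (fun t => (γ t).1) (X (γ t)).1 I t ∧
        HasDerivWithinAt (fun t => (γ t).2) (X (γ t)).2 I t := by
  refine forall₂_congr fun t ht => ⟨fun h => ⟨?_, ?_⟩, fun h => h.1.prodMk h.2⟩
  · exact (ContinuousLinearMap.fst ℝ ℝ ℝ).hasFDerivAt.comp_hasDerivWithinAt t h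
  · exact (ContinuousLinearMap.snd ℝ ℝ ℝ).hasFDerivAt.comp_hasDerivWithinAt t h

/-- The symmetry `(u, v, t, α, c) ↦ (1 - u, v + c, -t, 1 - α, -c)` of the slow system. -/
theorem isIntegralCurveOn_reflect {β κ γ₁ α c : ℝ} {γ : ℝ → ℝ × ℝ} {I J : Set ℝ}
    (hJ : MapsTo (fun t => -t) J I)
    (h : IsIntegralCurveOn γ (fun _ => slowField β κ γ₁ (1 - γ₁) α c) I) :
    IsIntegralCurveOn (fun t => (1 - (γ (-t)).1, (γ (-t)).2 + c))
      (fun _ => slowField β κ γ₁ (1 - γ₁) (1 - α) (-c)) J := by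
  rw [isIntegralCurveOn_prod_iff] at h ⊢
  intro t ht
  have h1 := (h (-t) (hJ ht)).1.comp t (hasDerivAt_neg t).hasDerivWithinAt hJ
  have h2 := (h (-t) (hJ ht)).2.comp t (hasDerivAt_neg t).hasDerivWithinAt hJ
  constructor
  · refine (h1.const_sub 1).congr_deriv ?_
    simp [slowField]; ring
  · refine (h2.add_const c).congr_deriv ?_
    simp [slowField, diffusivity, reaction]; ring

/-- The reflection exchanges the two saddles and the two outer branches, so only right segments need
analysis. -/
theorem hasLeftSegment_iff {β κ γ₁ α c ul vh : ℝ} :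
    HasLeftSegment β κ γ₁ (1 - γ₁) α c ul vh ↔
      HasRightSegment β κ γ₁ (1 - γ₁) (1 - α) (-c) (1 - ul) (vh + c) := by
  constructor
  · rintro ⟨Γ, ⟨h1, h2⟩, h3, h4, h5⟩
    refine ⟨fun t => (1 - (Γ (-t)).1, (Γ (-t)).2 + c),
      ⟨isIntegralCurveOn_reflect (fun t ht => ?_) h1, ?_⟩, fun t ht => ?_, fun t ht => ?_, ?_⟩
    · simpa using ht
    · have h := h2.comp tendsto_neg_atBot_atTop
      have := (((continuous_fst.tendsto _).comp h).const_sub 1).prodMk_nhds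
        (((continuous_snd.tendsto _).comp h).add_const c)
      simpa [Function.comp_def] using this
    · have := h3 (-t) (by linarith)
      simp only; linarith
    · have := h4 (-t) (by linarith)
      contrapose! this
      simp only at this; linarith
    · simp [h5]
  · rintro ⟨Γ, ⟨h1, h2⟩, h3, h4, h5⟩
    have hr := isIntegralCurveOn_reflect (J := Ici 0) (fun t ht => by simpa using ht) h1
    simp only [sub_sub_cancel, neg_neg] at hr
    refine ⟨_, ⟨hr, ?_⟩, fun t ht => ?_, fun t ht => ?_, ?_⟩
    · have h := h2.comp tendsto_neg_atTop_atBot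
      have := (((continuous_fst.tendsto _).comp h).const_sub 1).prodMk_nhds
        (((continuous_snd.tendsto _).comp h).add_const (-c))
      simpa [Function.comp_def] using this
    · have := h3 (-t) (by linarith)
      simp only; linarith
    · have := h4 (-t) (by linarith)
      contrapose! this
      simp only at this; linarith
    · simp [h5]

/-- The rate `G` for which `D(u) f(u) = s G(s)` with `s = 1 - u`. -/
def endRate (β κ γ₁ α s : ℝ) : ℝ :=
  diffusivity β γ₁ (1 - γ₁) (1 - s) * (κ * (1 - s) * (1 - s - α))

theorem mul_endRate (β κ γ₁ α s : ℝ) :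
    diffusivity β γ₁ (1 - γ₁) (1 - s) * reaction κ α (1 - s) = s * endRate β κ γ₁ α s := by
  unfold endRate reaction; ring

/-- The assumptions place `u = 1 - s` to the right of both `γ₂` and `α`, where `D` and the remaining
factors of `f` are positive. -/
theorem endRate_pos {β κ γ₁ α s : ℝ} (hβ : 0 < β) (hκ : 0 < κ) (hγ₁ : γ₁ < 1 / 2) (hs : s < γ₁)
    (hα : s < 1 - α) : 0 < endRate β κ γ₁ α s := by
  have h1 : 0 < 1 - s - γ₁ := by linarith
  have h2 : 0 < 1 - s - (1 - γ₁) := by linarith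
  have h3 : 0 < 1 - s := by linarith
  have h4 : 0 < 1 - s - α := by linarith
  unfold endRate diffusivity
  positivity

@[fun_prop]
theorem continuous_endRate (β κ γ₁ α : ℝ) : Continuous (endRate β κ γ₁ α) := by
  unfold endRate diffusivity; fun_prop

/-- The right slow segment reaches the section `{u = 1 - S}` exactly at the height given by the
profile. -/
theorem hasRightSegment_iff {β κ γ₁ α c S vh : ℝ} {z g : ℝ →ᵇ ℝ} (hβ : 0 < β) (hκ : 0 < κ)
    (hγ₁ : γ₁ < 1 / 2) (hS : 0 < S) (hSγ : S < γ₁) (hα : S < 1 - α)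
    (hz : ∃ μ > 0, ∀ s, μ ≤ z s)
    (h : z * z + (2 * c) • weightedAverage z - (2 : ℝ) • weightedAverage g = 0)
    (hg : ∀ x, 0 < x → x ≤ S → g x = endRate β κ γ₁ α x) :
    HasRightSegment β κ γ₁ (1 - γ₁) α c (1 - S) vh ↔ vh + c * (1 - S) = S * z S := by
  obtain ⟨μ, hμ, hzμ⟩ := hz
  have hzp : ∀ x, 0 < z x := fun x => hμ.trans_le (hzμ x)
  constructor
  · rintro ⟨Γ, ⟨h1, h2⟩, h3, h4, h5⟩
    rw [isIntegralCurveOn_prod_iff] at h1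
    have hu := (continuous_fst.tendsto _).comp h2
    have hv := (continuous_snd.tendsto _).comp h2
    simp only [Function.comp_def] at hu hv
    have huc : ContinuousOn (fun t => (Γ t).1) (Iic 0) :=
      fun t ht => (h1 t ht).1.continuousWithinAt
    -- The orbit starts near `s = 0`; exceeding `S` before time `0` would force an earlier crossing
    -- of the section.
    have hle : ∀ t ≤ 0, 1 - (Γ t).1 ≤ S := by
      intro t ht
      by_contra hlt
      push Not at hlt
      have hev : ∀ᶠ r in atBot, 1 - S < (Γ r).1 := hu.eventually_const_lt (by linarith)
      obtain ⟨r, hr, hrt⟩ := (hev.and (Iic_mem_atBot t)).exists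
      obtain ⟨x, hx, hx'⟩ := intermediate_value_Icc' (f := fun t => (Γ t).1) (mem_Iic.1 hrt)
        (huc.mono (fun x hx => hx.2.trans ht))
        (show 1 - S ∈ Icc (Γ t).1 (Γ r).1 from ⟨by linarith, hr.le⟩)
      have hxt : x ≠ t := by
        rintro rfl
        simp only at hx'
        linarith
      exact h4 x ((lt_of_le_of_ne hx.2 hxt).trans_le ht) hx'
    have := orbit_height_eq (G := endRate β κ γ₁ α) (s := fun t => 1 - (Γ t).1)
      (y := fun t => (Γ t).2 + c * (Γ t).1) hzp h (by fun_prop) hg (fun t ht => ?_)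
      (fun t ht => ?_) ?_ ?_ hS (by simp [h5]) hle (fun t ht => ?_)
    · simpa [h5] using this
    · refine ((h1 t ht).1.const_sub 1).congr_deriv ?_
      simp [slowField]
    · refine ((h1 t ht).2.add ((h1 t ht).1.const_mul c)).congr_deriv ?_
      rw [← mul_endRate]
      simp [slowField]; ring
    · simpa using hu.const_sub 1
    · simpa using hv.add (hu.const_mul c)
    · have := h3 t ht
      have := hle t ht
      exact endRate_pos hβ hκ hγ₁ (by linarith) (by linarith)
  · intro hvh
    obtain ⟨s, hs0, hsm, hsp, hst, hsd⟩ := exists_orbit_on_profile hμ hzμ hS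
    have hsS : ∀ t ≤ 0, s t ≤ S := fun t ht => hs0 ▸ hsm.monotone ht
    have hyd : ∀ t ≤ 0, HasDerivAt (fun t => s t * z (s t))
        (s t * endRate β κ γ₁ α (s t) - c * (s t * z (s t))) t := fun t ht => by
      refine ((hasDerivAt_mul_profile hzp h (hsp t)).comp t (hsd t)).congr_deriv ?_
      rw [hg _ (hsp t) (hsS t ht)]
      have := (hzp (s t)).ne'
      field_simp
    refine ⟨fun t => (1 - s t, s t * z (s t) - c * (1 - s t)), ⟨?_, ?_⟩, fun t ht => ?_,
      fun t ht => ?_, ?_⟩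
    · rw [isIntegralCurveOn_prod_iff]
      intro t ht
      constructor
      · refine ((hsd t).const_sub 1).hasDerivWithinAt.congr_deriv ?_
        simp [slowField]
      · refine ((hyd t ht).sub (((hsd t).const_sub 1).const_mul c)).hasDerivWithinAt.congr_deriv ?_
        rw [← mul_endRate]
        simp [slowField]
    · have := (hst.const_sub 1).prodMk_nhds
        ((hst.mul ((z.continuous.tendsto 0).comp hst)).sub ((hst.const_sub 1).const_mul c))
      simpa using this
    · have := hsS t ht
      simp only; linarith
    · have := hsm ht
      rw [hs0] at this
      simp only; intro h; linarith
    · simp only [hs0]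
      ext
      · rfl
      · simp only; linarith

/-! ### The matching height and the speed curve -/

/-- Analytic implicit functions of one variable for an equation that is strictly decreasing in both
variables. -/
theorem exists_decreasing_implicit_curve {W : ℝ × ℝ → ℝ} {W' : ℝ × ℝ →L[ℝ] ℝ} {x₀ : ℝ}
    {U : Set (ℝ × ℝ)} (hW : ContDiffAt ℝ ω W (x₀, 0)) (hW0 : W (x₀, 0) = 0)
    (hW' : HasFDerivAt W W' (x₀, 0)) (h1 : W' (1, 0) < 0) (h2 : W' (0, 1) < 0)
    (hU : U ∈ 𝓝 (x₀, 0)) :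
    ∃ (h ρ : ℝ) (c : ℝ → ℝ), 0 < h ∧ h ≤ 1 / 2 ∧ 0 < ρ ∧
      ContDiffOn ℝ ∞ c (Ioo (x₀ - h) (x₀ + h)) ∧ c x₀ = 0 ∧ deriv c x₀ < 0 ∧
      (∀ α ∈ Ioo (x₀ - h) (x₀ + h), |c α| < ρ ∧
        ∀ c' : ℝ, |c'| < ρ → (α, c') ∈ U ∧ (W (α, c') = 0 ↔ c' = c α)) ∧
      (∀ α ∈ Ioo (x₀ - h) x₀, 0 < c α) ∧ ∀ α ∈ Ioo x₀ (x₀ + h), c α < 0 := by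
  have hω : (ω : WithTop ℕ∞) ≠ 0 := by simp
  have hinv : (fderiv ℝ W (x₀, 0) ∘L .inr ℝ ℝ ℝ).IsInvertible := by
    rw [hW'.fderiv]
    refine ⟨ContinuousLinearEquiv.unitsEquivAut ℝ (Units.mk0 _ h2.ne), ?_⟩
    ext
    simp
  set c := hW.implicitFunction hω hinv with hc
  have hcd : ContDiffAt ℝ ω c x₀ := hW.contDiffAt_implicitFunction hω hinv
  have hc0 : c x₀ = 0 := hW.implicitFunction_apply_self hω hinv
  have hiff := hW.eventually_apply_eq_iff_implicitFunction hω hinv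
  have happ : ∀ᶠ x in 𝓝 x₀, W (x, c x) = W (x₀, 0) :=
    hW.eventually_apply_implicitFunction hω hinv
  have hder : HasDerivAt c (deriv c x₀) x₀ := (hcd.differentiableAt hω).hasDerivAt
  have hneg : deriv c x₀ < 0 := by
    have hcomp : HasDerivAt (fun x => W (x, c x)) (W' (1, deriv c x₀)) x₀ := by
      have hp : HasDerivAt (fun x => (x, c x)) (1, deriv c x₀) x₀ := (hasDerivAt_id x₀).prodMk hder
      exact HasFDerivAt.comp_hasDerivAt x₀ (by simpa only [hc0] using hW') hp
    have h0 : W' (1, deriv c x₀) = 0 :=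
      hcomp.unique ((hasDerivAt_const x₀ (W (x₀, 0))).congr_of_eventuallyEq happ)
    -- Differentiating `W (x, c x) = 0` gives `W_α + c' W_c = 0`; two negative partials force `c' <
    -- 0`.
    have he : ((1, deriv c x₀) : ℝ × ℝ) = (1, 0) + deriv c x₀ • (0, 1) := by ext <;> simp
    rw [he, map_add, map_smul, smul_eq_mul] at h0
    by_contra hn
    nlinarith
  have hsign : ∀ᶠ x in 𝓝 x₀, (x < x₀ → 0 < c x) ∧ (x₀ < x → c x < 0) := by
    have := (hasDerivAt_iff_tendsto_slope.1 hder).eventually_lt_const hneg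
    rw [eventually_nhdsWithin_iff] at this
    filter_upwards [this] with x hx
    refine ⟨fun hlt => ?_, fun hlt => ?_⟩
    · have h3 := hx hlt.ne
      rw [slope_def_field, hc0, sub_zero] at h3
      by_contra hn
      exact h3.not_ge (div_nonneg_of_nonpos (not_lt.1 hn) (by linarith))
    · have h3 := hx hlt.ne'
      rw [slope_def_field, hc0, sub_zero] at h3
      by_contra hn
      exact h3.not_ge (div_nonneg (not_lt.1 hn) (by linarith))
  -- The radius `ε` serves as `ρ`. The window in `α` is shrunk to at most `ε` so that each `(α, c')`
  -- lies in this sup-norm ball.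
  obtain ⟨ε, hε, hball⟩ := Metric.eventually_nhds_iff.1 (hiff.and hU)
  have hsmall : ∀ᶠ x in 𝓝 x₀, |c x| < ε := by
    have := hcd.continuousAt.abs.eventually_lt_const (show |c x₀| < ε by simpa [hc0])
    exact this
  obtain ⟨δ, hδ, hδb⟩ := Metric.eventually_nhds_iff.1
    ((hsign.and hsmall).and (hcd.eventually (by simp)))
  have hd : ∀ α ∈ Ioo (x₀ - min (min δ ε) (1 / 2)) (x₀ + min (min δ ε) (1 / 2)),
      |α - x₀| < δ ∧ |α - x₀| < ε := fun α hα => by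
    have : |α - x₀| < min (min δ ε) (1 / 2) := abs_lt.2 ⟨by linarith [hα.1], by linarith [hα.2]⟩
    exact ⟨this.trans_le ((min_le_left _ _).trans (min_le_left _ _)),
      this.trans_le ((min_le_left _ _).trans (min_le_right _ _))⟩
  have hm : 0 < min (min δ ε) (1 / 2) := by positivity
  refine ⟨min (min δ ε) (1 / 2), ε, c, hm, min_le_right _ _, hε, fun α hα => ?_, hc0, hneg,
    fun α hα => ?_, fun α hα => ?_, fun α hα => ?_⟩
  · exact ((hδb (hd α hα).1).2.of_le le_top).contDiffWithinAt
  · refine ⟨(hδb (hd α hα).1).1.2, fun c' hc' => ?_⟩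
    have hb := @hball (α, c') (by
      rw [Prod.dist_eq]
      exact max_lt (hd α hα).2 (by simpa [Real.dist_eq] using hc'))
    refine ⟨hb.2, ?_⟩
    rw [← hW0, hb.1]
    exact eq_comm
  · exact (hδb (hd α ⟨hα.1, by linarith [hα.2]⟩).1).1.1.1 hα.2
  · exact (hδb (hd α ⟨by linarith [hα.1], hα.2⟩).1).1.1.2 hα.1

/-- Implicit differentiation of the profile equation at a point. -/
theorem profile_partials {φ ψ : ℝ × ℝ → ℝ} {φ' ψ' : ℝ × ℝ →L[ℝ] ℝ} {α₀ a b : ℝ}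
    (hφ : HasFDerivAt φ φ' (α₀, 0)) (hψ : HasFDerivAt ψ ψ' (α₀, 0))
    (heq : ∀ᶠ p in 𝓝 (α₀, (0 : ℝ)), φ p * φ p + 2 * p.2 * ψ p - 2 * (a - p.1 * b) = 0) :
    φ (α₀, 0) * φ' (1, 0) = -b ∧ φ (α₀, 0) * φ' (0, 1) = -ψ (α₀, 0) := by
  have h1 := ((hφ.mul hφ).add
    (((hasFDerivAt_snd (𝕜 := ℝ) (p := (α₀, (0 : ℝ)))).const_mul (2 : ℝ)).mul hψ)).sub
    ((((hasFDerivAt_fst (𝕜 := ℝ) (p := (α₀, (0 : ℝ)))).mul_const b).const_sub a).const_mul 2)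
  have h0 := h1.unique
    ((hasFDerivAt_const (0 : ℝ) (α₀, (0 : ℝ))).congr_of_eventuallyEq heq)
  have ha := congrArg (fun L : ℝ × ℝ →L[ℝ] ℝ => L (1, 0)) h0
  have hb := congrArg (fun L : ℝ × ℝ →L[ℝ] ℝ => L (0, 1)) h0
  simp at ha hb
  constructor <;> linarith

/-- Extension of a function on `[0, S]` to a bounded function that is constant outside. -/
noncomputable def clampExtend {S : ℝ} (hS : 0 ≤ S) (f : C(ℝ, ℝ)) : ℝ →ᵇ ℝ :=
  (BoundedContinuousFunction.mkOfCompact (f.restrict (Icc 0 S))).compContinuous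
    ⟨projIcc 0 S hS, continuous_projIcc⟩

theorem clampExtend_apply {S : ℝ} (hS : 0 ≤ S) (f : C(ℝ, ℝ)) (s : ℝ) :
    clampExtend hS f s = f (projIcc 0 S hS s) := rfl

/-- The height, relative to the nullcline `v + c u = 0`, at which the unstable manifold of the right
saddle meets the section `{u = 1 - S}`. -/
theorem exists_segment_height {β κ γ₁ S : ℝ} (hβ : 0 < β) (hκ : 0 < κ) (hγ₁ : γ₁ < 1 / 2)
    (hS : 0 < S) (hSγ : S < γ₁) :
    ∃ (φ : ℝ × ℝ → ℝ) (φ' : ℝ × ℝ →L[ℝ] ℝ), ContDiffAt ℝ ω φ (1 / 2, 0) ∧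
      HasFDerivAt φ φ' (1 / 2, 0) ∧ φ' (1, 0) < 0 ∧ φ' (0, 1) < 0 ∧
      ∀ᶠ p in 𝓝 ((1 / 2 : ℝ), (0 : ℝ)), ∀ vh,
        (HasRightSegment β κ γ₁ (1 - γ₁) p.1 p.2 (1 - S) vh ↔ vh + p.2 * (1 - S) = φ p) := by
  -- The rate is affine in `α`: `G = P - α Q`. Averages at `s ≤ S` only see `[0, S]`, and clamping
  -- keeps uniform positive lower bounds on the whole line.
  set P : ℝ →ᵇ ℝ := clampExtend hS.le ⟨endRate β κ γ₁ 0, by fun_prop⟩ with hP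
  set Q : ℝ →ᵇ ℝ := clampExtend hS.le
    ⟨fun s => diffusivity β γ₁ (1 - γ₁) (1 - s) * (κ * (1 - s)),
      by unfold diffusivity; fun_prop⟩ with hQ
  have hPQ : ∀ α s, P s - α * Q s = endRate β κ γ₁ α (projIcc 0 S hS.le s) := fun α s => by
    simp only [hP, hQ, clampExtend_apply, ContinuousMap.coe_mk, endRate]; ring
  have hbound : ∀ f : ℝ → ℝ, Continuous f → (∀ s ∈ Icc 0 S, 0 < f s) →
      ∃ m > 0, ∀ s : ℝ, m ≤ f (projIcc 0 S hS.le s) := fun f hf hfp => by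
    obtain ⟨x, hx, hmin⟩ := isCompact_Icc.exists_isMinOn (nonempty_Icc.2 hS.le) hf.continuousOn
    exact ⟨f x, hfp x hx, fun s => hmin (projIcc 0 S hS.le s).2⟩
  obtain ⟨m, hm, hmP⟩ := hbound (endRate β κ γ₁ (1 / 2)) (by fun_prop) (fun s hs =>
    endRate_pos hβ hκ hγ₁ (hs.2.trans_lt hSγ) (by linarith [hs.2]))
  obtain ⟨m', hm', hmQ⟩ := hbound (fun s => diffusivity β γ₁ (1 - γ₁) (1 - s) * (κ * (1 - s)))
    (by unfold diffusivity; fun_prop) (fun s hs => by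
      have h1 : 0 < 1 - s - γ₁ := by linarith [hs.2]
      have h2 : 0 < 1 - s - (1 - γ₁) := by linarith [hs.2]
      have h3 : 0 < 1 - s := by linarith [hs.2]
      unfold diffusivity
      positivity)
  obtain ⟨Z, hZ, hev⟩ := exists_profile P Q (α₀ := 1 / 2) hm (fun s => by rw [hPQ]; exact hmP s)
  have hφc : ContDiffAt ℝ ω (fun p => Z p S) (1 / 2, 0) :=
    ContDiffAt.comp (g := BoundedContinuousFunction.evalCLM ℝ S) _
      (ContinuousLinearMap.contDiff _).contDiffAt hZ
  have hψc : ContDiffAt ℝ ω (fun p => weightedAverage (Z p) S) (1 / 2, 0) :=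
    ContDiffAt.comp (g := (BoundedContinuousFunction.evalCLM ℝ S).comp weightedAverage) _
      (ContinuousLinearMap.contDiff _).contDiffAt hZ
  have hω : (ω : WithTop ℕ∞) ≠ 0 := by simp
  have hφ := (hφc.differentiableAt hω).hasFDerivAt
  have hψ := (hψc.differentiableAt hω).hasFDerivAt
  obtain ⟨⟨μ, hμ, hZμ⟩, -⟩ := hev.self_of_nhds
  have hZS : 0 < Z (1 / 2, 0) S := hμ.trans_le (hZμ S)
  have hAQ : 0 < weightedAverage Q S := by
    have := const_le_two_mul_weightedAverage (z := Q) (m := m') hmQ S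
    linarith
  have hAZ : 0 < weightedAverage (Z (1 / 2, 0)) S := by
    have := const_le_two_mul_weightedAverage hZμ S
    linarith
  obtain ⟨h1, h2⟩ := profile_partials (a := weightedAverage P S) (b := weightedAverage Q S) hφ hψ
    (hev.mono fun p hp => by
      have := congrArg (fun w : ℝ →ᵇ ℝ => w S) hp.2
      simpa [profileMap] using this)
  refine ⟨fun p => S * Z p S, S • fderiv ℝ (fun p => Z p S) (1 / 2, 0), contDiffAt_const.mul hφc,
    hφ.const_mul S, mul_neg_of_pos_of_neg hS ?_, mul_neg_of_pos_of_neg hS ?_, ?_⟩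
  · exact (pos_iff_neg_of_mul_neg (h1.trans_lt (neg_lt_zero.2 hAQ))).1 hZS
  · exact (pos_iff_neg_of_mul_neg (h2.trans_lt (neg_lt_zero.2 hAZ))).1 hZS
  · have hα : ∀ᶠ p in 𝓝 ((1 / 2 : ℝ), (0 : ℝ)), p.1 < 1 - S :=
      (continuous_fst.tendsto _).eventually_lt_const (by simp only; linarith)
    filter_upwards [hev, hα] with p hp hpα vh
    refine hasRightSegment_iff hβ hκ hγ₁ hS hSγ (by linarith) hp.1 hp.2 (fun x hx hxS => ?_)
    change P x - p.1 * Q x = _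
    rw [hPQ, projIcc_of_mem hS.le ⟨hx.le, hxS⟩]

end ShockFront

/-! ### Matching the two slow segments -/

theorem mainTheorem2 (β κ γ₁ γ₂ : ℝ) (hβ : 0 < β) (hκ : 0 < κ)
    (hγ : 1 / 2 - Real.sqrt 3 / 6 < γ₁) (hγ₁ : γ₁ < 1 / 2) (hγ₂ : γ₂ = 1 - γ₁) :
    ∃ ul ur : ℝ, 0 < ul ∧ ur < 1 ∧ ShockFront.EqualAreaRule β γ₁ γ₂ ul ur ∧
      ∃ (h ρ : ℝ) (c : ℝ → ℝ), 0 < h ∧ h ≤ 1 / 2 ∧ 0 < ρ ∧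
        ContDiffOn ℝ ∞ c (Ioo (1 / 2 - h) (1 / 2 + h)) ∧
        c (1 / 2) = 0 ∧
        deriv c (1 / 2) < 0 ∧
        (∀ α ∈ Ioo (1 / 2 - h) (1 / 2 + h), |c α| < ρ ∧
          ∀ c' : ℝ, |c'| < ρ →
            (ShockFront.IsSingularHeteroclinic β κ γ₁ γ₂ 0 α c' ul ur ↔ c' = c α)) ∧
        (∀ α ∈ Ioo (1 / 2 - h) (1 / 2), 0 < c α) ∧
        (∀ α ∈ Ioo (1 / 2) (1 / 2 + h), c α < 0) := by
  subst hγ₂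
  have h3 : √3 ^ 2 = 3 := Real.sq_sqrt (by norm_num)
  have h3p : 0 < √3 := by positivity
  set r : ℝ := √3 * (1 / 2 - γ₁) with hr
  have hr0 : 0 < r := mul_pos h3p (by linarith)
  have hr2 : r ^ 2 = 3 * (1 / 2 - γ₁) ^ 2 := by rw [hr, mul_pow, h3]
  -- The lower bound on `γ₁` gives `r < √3 * (√3 / 6) = 1 / 2`.
  have hr1 : r < 1 / 2 := by
    have : √3 * (1 / 2 - γ₁) < √3 * (√3 / 6) := mul_lt_mul_of_pos_left (by linarith) h3p
    nlinarith
  have harea := ShockFront.equalAreaRule_symmetric (β := β) hγ₁ hr2 hr0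
  have hSγ : 1 / 2 - r < γ₁ := harea.1
  have hS : 0 < 1 / 2 - r := by linarith
  refine ⟨1 / 2 - r, 1 / 2 + r, hS, by linarith, harea, ?_⟩
  obtain ⟨φ, φ', hφ, hφ', h1, h2, hseg⟩ :=
    ShockFront.exists_segment_height hβ hκ hγ₁ hS hSγ
  set σ : ℝ × ℝ → ℝ × ℝ := fun p => (1 - p.1, -p.2) with hσ
  have hσ0 : σ (1 / 2, 0) = (1 / 2, 0) := by ext <;> simp [hσ]; norm_num
  have hσc : ContDiff ℝ ω σ := (contDiff_const.sub contDiff_fst).prodMk contDiff_snd.neg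
  have hσ' : HasFDerivAt σ (-ContinuousLinearMap.id ℝ (ℝ × ℝ)) (1 / 2, 0) := by
    have := ((hasFDerivAt_id (𝕜 := ℝ) ((1 / 2 : ℝ), (0 : ℝ))).const_sub (1, 0))
    refine this.congr_of_eventuallyEq (Eventually.of_forall fun p => ?_)
    ext <;> simp [hσ]
  have hσt := hσc.continuous.tendsto (1 / 2, 0)
  rw [hσ0] at hσt
  have hσseg := hσt.eventually hseg
  have hbox : ∀ᶠ p in 𝓝 ((1 / 2 : ℝ), (0 : ℝ)), 0 < p.1 ∧ p.1 < 1 :=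
    ((continuous_fst.tendsto _).eventually_const_lt (by norm_num)).and
      ((continuous_fst.tendsto _).eventually_lt_const (by norm_num))
  -- The segments require `v_h = φ(α, c) - c (1/2 + r)` and `v_h = φ(1 - α, -c) - c (1/2 - r)`; the
  -- difference is the matching function. As `σ` has derivative `-1`, its derivative is `2 φ'` minus
  -- the `2 r c` term.
  have hW' : HasFDerivAt (fun p : ℝ × ℝ => φ p - φ (σ p) - p.2 * (2 * r))
      (φ' - φ'.comp (-ContinuousLinearMap.id ℝ (ℝ × ℝ))
        - (2 * r) • ContinuousLinearMap.snd ℝ ℝ ℝ) (1 / 2, 0) :=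
    (hφ'.sub (HasFDerivAt.comp _ (hσ0.symm ▸ hφ') hσ')).sub
      (hasFDerivAt_snd.mul_const (2 * r))
  obtain ⟨h, ρ, c, hh, hh2, hρ, hc, hc0, hcd, hmain, hpos, hneg⟩ :=
    ShockFront.exists_decreasing_implicit_curve
      (W := fun p => φ p - φ (σ p) - p.2 * (2 * r)) (x₀ := 1 / 2)
      ((hφ.sub (ContDiffAt.comp _ (hσ0.symm ▸ hφ) hσc.contDiffAt)).sub
        (contDiffAt_snd.mul contDiffAt_const))
      (by rw [hσ0]; ring) hW' (by simp; linarith) (by simp; linarith) ((hseg.and hσseg).and hbox)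
  refine ⟨h, ρ, c, hh, hh2, hρ, hc, hc0, hcd, fun α hα => ⟨(hmain α hα).1, fun c' hc' => ?_⟩,
    hpos, hneg⟩
  obtain ⟨⟨⟨hright, hleft⟩, hα0, hα1⟩, hiff⟩ := (hmain α hα).2 c' hc'
  have hur : 1 - (1 / 2 - r) = 1 / 2 + r := by ring
  simp only [hur, hσ] at hright hleft
  have hγ₁0 : 0 < γ₁ := hS.trans hSγ
  rw [← hiff]
  constructor
  · rintro ⟨-, -, vh, hr, -, hl⟩
    have e1 := (hright vh).1 hr
    have e2 := (hleft _).1 (by simpa only [hur] using ShockFront.hasLeftSegment_iff.1 hl)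
    simp only [hσ]
    linarith
  · intro hW
    simp only [hσ] at hW
    refine ⟨ShockFront.isSaddle_one c' hβ hκ hγ₁0 (by linarith) hα1,
      ShockFront.isSaddle_zero c' hβ hκ hγ₁0 (by linarith) hα0, φ (α, c') - c' * (1 / 2 + r),
      (hright _).2 (by ring), ?_, ShockFront.hasLeftSegment_iff.2 ?_⟩
    -- The damping is `0 * c'`, so the jump does not depend on the speed.
    · simpa only [zero_mul] using ShockFront.exists_fast_jump hβ hr2 hr0
    · rw [hur, hleft]
      linarith
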